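/- Let $\mathbb{F}_q$ be a finite field with $q$ elements, $q$ odd, and let $\gamma \in \mathbb{F}_q^*$. For $k \geq 0$ let $\mathcal{M}_k$ be the set of monic polynomials of degree $k$ in $\mathbb{F}_q[T]$. For $A \in \mathbb{F}_q[T]$ and $h \geq 0$ let $I(A;h) := \{ B \in \mathbb{F}_q[T] : \deg (B-A) < h \}$, where $\deg 0 = -\infty$. For integers $0 \leq m \leq n-1$ and $B \in \mathbb{F}_q[T]$ let $$S_{\gamma;m}(B) := \big| \{ (E,F) \in \mathcal{M}_n \times \mathcal{M}_m : B = E^2 + \gamma F^2 \} \big| ,$$ and for $0 \leq h \leq 2n$ define the mean and the variance $$\mu := \frac{1}{q^{2n}} \sum_{A \in \mathcal{M}_{2n}} \sum_{B \in I(A;h)} S_{\gamma;m}(B) , \qquad V := \frac{1}{q^{2n}} \sum_{A \in \mathcal{M}_{2n}} \Big( \sum_{B \in I(A;h)} S_{\gamma;m}(B) - \mu \Big)^2 .$$ Then the following hold. If $m \geq 1$ and $m+1 \leq n \leq 2m-1$, then $$V = \begin{cases} 0 & \text{if } m \leq h \leq 2n, \\ \frac{q^h}{q^n} (q^m - q^h)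 & \text{if } 2m-n \leq h \leq m-1, \\ \frac{q^{m+h}}{q^{2n}} \big[ q^n - q^m + (2m-n-h)(q-1) q^{m-1} \big] & \text{if } 0 \leq h \leq 2m-n-1. \end{cases}$$ If $m \geq 1$ and $n = 2m$, then $$V = \begin{cases} 0 & \text{if } m \leq h \leq 2n, \\ \frac{q^h}{q^n} (q^m - q^h) & \text{if } 0 \leq h \leq m-1. \end{cases}$$ If $m \geq 1$ and $n \geq 2m+1$, then $$V = \begin{cases} 0 & \text{if } n \leq h \leq 2n, \\ \frac{q^{2m+h}}{q^{2n}} (q^n - q^h) & \text{if } 2m \leq h \leq n-1, \\ \frac{q^{2h}}{q^{2n}} (q^n - q^{2m}) & \text{if } m \leq h \leq 2m-1, \\ \frac{q^{m+h}}{q^{2n}} (q^n - q^{m+h}) & \text{if } 0 \leq h \leq m-1. \end{cases}$$ If $m = 0$ and $n \geq 1$, then $$V = \begin{cases} 0 & \text{if } n \leq h \leq 2n, \\ \frac{q^h}{q^{2n}} (q^n - q^h) & \text{if } 0 \leq h \leq n-1. \end{cases}$$ -/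

import Mathlib

open Polynomial

namespace TwoSquares

/-- There are only finitely many polynomials of degree `< h` over a finite field. -/
theorem finite_degree_lt (F : Type*) [Field F] [Finite F] (h : ℕ) :
    {C : F[X] | C.degree < (h : WithBot ℕ)}.Finite := by
  have hfin : Finite (degreeLT F h) :=
    Finite.of_equiv (Fin h → F) (degreeLTEquiv F h).toEquiv.symm
  refine (Set.toFinite (degreeLT F h : Set F[X])).subset ?_
  intro C hC
  exact mem_degreeLT.2 hC

/-- There are only finitely many monic polynomials of degree `n` over a finite field. -/
theorem finite_monic (F : Type*) [Field F] [Finite F] (n : ℕ) :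
    {A : F[X] | A.Monic ∧ A.natDegree = n}.Finite := by
  refine (finite_degree_lt F (n + 1)).subset ?_
  rintro A ⟨hA, hn⟩
  show A.degree < _
  rw [degree_eq_natDegree hA.ne_zero, hn]
  exact_mod_cast Nat.lt_succ_self n

/-- The intervals `{B : deg (B - A) < h}` are finite. -/
theorem finite_interval {F : Type*} [Field F] [Finite F] (A : F[X]) (h : ℕ) :
    {B : F[X] | (B - A).degree < (h : WithBot ℕ)}.Finite :=
  (finite_degree_lt F h).preimage (sub_left_injective.injOn)

/-- The finite set of monic polynomials of degree `n` in `F[X]`. -/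
noncomputable def monics (F : Type*) [Field F] [Finite F] (n : ℕ) : Finset F[X] :=
  (finite_monic F n).toFinset

/-- The interval `I(A; h) = {B : deg (B - A) < h}`, where `deg 0 = -∞`. -/
noncomputable def interval {F : Type*} [Field F] [Finite F] (A : F[X]) (h : ℕ) : Finset F[X] :=
  (finite_interval A h).toFinset

open Classical in
/-- `S_{γ;m}(B)`, for `B` of degree `2n`: the number of pairs `(E, G)` of monic polynomials,
`E` of degree `n` and `G` of degree `m`, with `B = E ^ 2 + γ G ^ 2`. -/
noncomputable def numReps {F : Type*} [Field F] [Finite F] (γ : F) (n m : ℕ) (B : F[X]) : ℕ :=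
  ((monics F n ×ˢ monics F m).filter fun p => B = p.1 ^ 2 + C γ * p.2 ^ 2).card

/-- The sum of `S_{γ;m}` over the interval `I(A; h)`. -/
noncomputable def intervalSum {F : Type*} [Field F] [Finite F] (γ : F) (n m h : ℕ) (A : F[X]) :
    ℝ :=
  ∑ B ∈ interval A h, (numReps γ n m B : ℝ)

/-- The mean of the interval sums, over all monic centres `A` of degree `2n`. -/
noncomputable def mean {F : Type*} [Field F] [Fintype F] (γ : F) (n m h : ℕ) : ℝ :=
  1 / (Fintype.card F : ℝ) ^ (2 * n) * ∑ A ∈ monics F (2 * n), intervalSum γ n m h A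

/-- The variance of the interval sums, over all monic centres `A` of degree `2n`. -/
noncomputable def variance {F : Type*} [Field F] [Fintype F] (γ : F) (n m h : ℕ) : ℝ :=
  1 / (Fintype.card F : ℝ) ^ (2 * n) *
    ∑ A ∈ monics F (2 * n), (intervalSum γ n m h A - mean γ n m h) ^ 2

end TwoSquares

namespace TwoSquares

/-! ### First and second moments of the interval sums. -/

section Basic

/-! Intervals of equal radius are equal or disjoint, so the second moment equals `q ^ h` times the
number of pairs of representations whose values differ by degree less than `h` (`variance_eq`); the
mean is `q ^ (h + m - n)`. Factoring differences of squares turns a pair of representations into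
midpoints `Y`, `W`, monic of degrees `n`, `m`, and differences `X`, `U` of degrees below `n`, `m`,
subject to the linear condition `deg (X * Y + U * W) < h` (`pairCount_eq`).

If `n ≥ 2 * m`, or if `h ≥ m`, the number of solutions `(X, U)` does not depend on `Y`, `W`: either
`X` is forced to be zero, or division by `W` counts the `U` for each `X`. The variance vanishes
exactly when this number is `q ^ (m + h - n)`.

For `n < 2 * m` and `h < m`, `X` determines `U`, and what remains is that `X * Y` modulo `W` be
small. Averaging over `Y`, which is equidistributed modulo `W`, gives the weight `q ^ max h (deg
(gcd X W))` (`pairCount_eq_sum_gcd`). Sorting by the gcd evaluates the sum of these weights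
(`gcdSum_pow_max`, `smallGcdSum_add`); the `X` of degree greater than `h` produce the term linear in
`2 * m - n - h`. -/

theorem degree_sub_lt_comm {F : Type*} [Field F] {P Q : F[X]} {h : WithBot ℕ} :
    (P - Q).degree < h ↔ (Q - P).degree < h := by
  rw [← neg_sub, degree_neg]

theorem degree_sub_lt_trans {F : Type*} [Field F] {P Q R : F[X]} {h : WithBot ℕ} (h1 : (P - Q).degree < h)
    (h2 : (Q - R).degree < h) : (P - R).degree < h := by
  rw [← sub_add_sub_cancel P Q R]
  exact (degree_add_le _ _).trans_lt (max_lt h1 h2)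

variable {F : Type*} [Field F] [Fintype F]

/-- The finite set of polynomials of degree less than `h`. -/
noncomputable def degLT (F : Type*) [Field F] [Finite F] (h : ℕ) : Finset F[X] :=
  (finite_degree_lt F h).toFinset

@[simp]
theorem mem_degLT {h : ℕ} {P : F[X]} : P ∈ degLT F h ↔ P.degree < (h : WithBot ℕ) := by
  simp [degLT]

@[simp]
theorem mem_monics {n : ℕ} {P : F[X]} : P ∈ monics F n ↔ P.Monic ∧ P.natDegree = n := by
  simp [monics]

@[simp]
theorem mem_interval {h : ℕ} {A B : F[X]} :
    B ∈ interval A h ↔ (B - A).degree < (h : WithBot ℕ) := by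
  simp [interval]

theorem card_degLT (h : ℕ) : (degLT F h).card = Fintype.card F ^ h := by
  have e := Nat.card_congr (degreeLTEquiv F h).toEquiv
  rw [Nat.card_fun, Nat.card_fin, Nat.card_eq_fintype_card (α := F)] at e
  rw [← e, degLT, ← Set.ncard_eq_toFinset_card _ (finite_degree_lt F h),
    ← Nat.card_coe_set_eq]
  refine Nat.card_congr (Equiv.subtypeEquivRight fun P => ?_)
  simp [mem_degreeLT]

theorem degree_of_mem_monics {n : ℕ} {P : F[X]} (hP : P ∈ monics F n) : P.degree = n := by
  rw [mem_monics] at hP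
  rw [degree_eq_natDegree hP.1.ne_zero, hP.2]

theorem mem_monics_of_degree_sub_lt {n : ℕ} {P Q : F[X]} (hP : P ∈ monics F n)
    (h : (Q - P).degree < (n : WithBot ℕ)) : Q ∈ monics F n := by
  have hd := degree_of_mem_monics hP
  rw [← hd] at h
  have hQ : Q = P + (Q - P) := by ring
  rw [mem_monics] at hP ⊢
  have hm : Q.Monic := by rw [hQ]; exact hP.1.add_of_left h
  refine ⟨hm, ?_⟩
  rw [← hP.2, hQ]
  exact natDegree_eq_of_degree_eq (degree_add_eq_left_of_degree_lt h)

theorem card_monics (n : ℕ) : (monics F n).card = Fintype.card F ^ n := by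
  rw [← card_degLT]
  have hX : (X ^ n : F[X]) ∈ monics F n := by simp [monic_X_pow]
  refine Finset.card_nbij' (fun P => P - X ^ n) (fun P => P + X ^ n) ?_ ?_ ?_ ?_
  · intro P hP
    have hP' := hP
    simp only [Finset.mem_coe, mem_degLT, mem_monics] at hP ⊢
    rw [← degree_of_mem_monics hP']
    refine degree_sub_lt_left ?_ hP.1.ne_zero ?_
    · rw [degree_of_mem_monics hP', degree_X_pow]
    · rw [hP.1, monic_X_pow]
  · intro P hP
    simp only [Finset.mem_coe, mem_degLT] at hP ⊢
    exact mem_monics_of_degree_sub_lt hX (by simpa using hP)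
  · intro P _; simp
  · intro P _; simp

theorem degree_mul_monic_lt {P W : F[X]} {m h : ℕ} (hW : W ∈ monics F m) :
    (P * W).degree < (h : WithBot ℕ) ↔ P.degree < ((h - m : ℕ) : WithBot ℕ) := by
  rw [degree_mul, degree_of_mem_monics hW]
  by_cases hP : P = 0
  · simp [hP]
  · rw [degree_eq_natDegree hP]
    norm_cast
    omega

/-- The interval sum counts pairs `(E, G)` whose value lies near the centre. -/
theorem intervalSum_eq_card (γ : F) (n m h : ℕ) (A : F[X]) :
    intervalSum γ n m h A = ∑ p ∈ monics F n ×ˢ monics F m,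
      if (p.1 ^ 2 + C γ * p.2 ^ 2 - A).degree < (h : WithBot ℕ) then (1 : ℝ) else 0 := by
  classical
  simp only [intervalSum, numReps, Finset.card_filter, Nat.cast_sum, Nat.cast_ite, Nat.cast_one,
    Nat.cast_zero]
  rw [Finset.sum_comm]
  refine Finset.sum_congr rfl fun p _ => ?_
  rw [Finset.sum_ite_eq']
  simp

theorem sq_add_mem_monics {n m : ℕ} (hmn : m < n) (γ : F) {E G : F[X]} (hE : E ∈ monics F n)
    (hG : G ∈ monics F m) : E ^ 2 + C γ * G ^ 2 ∈ monics F (2 * n) := by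
  have hE2 : E ^ 2 ∈ monics F (2 * n) := by
    rw [mem_monics] at hE ⊢
    exact ⟨hE.1.pow 2, by rw [hE.1.natDegree_pow, hE.2]⟩
  refine mem_monics_of_degree_sub_lt hE2 ?_
  rw [add_sub_cancel_left]
  by_cases hγ : γ = 0
  · rw [hγ, C_0, zero_mul, degree_zero]; exact WithBot.bot_lt_coe _
  rw [degree_C_mul hγ, degree_pow, degree_of_mem_monics hG]
  simp
  omega

theorem card_monics_near {n h : ℕ} (hh : h ≤ n) {B : F[X]} (hB : B ∈ monics F n) :
    ((monics F n).filter fun A => (B - A).degree < (h : WithBot ℕ)).card = Fintype.card F ^ h := by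
  rw [← card_degLT]
  refine Finset.card_nbij' (fun A => B - A) (fun P => B - P) ?_ ?_ ?_ ?_
  · intro A hA
    simp only [Finset.coe_filter, Set.mem_ofPred_eq] at hA
    simpa using hA.2
  · intro P hP
    simp only [Finset.mem_coe, mem_degLT, Finset.mem_filter] at hP ⊢
    refine ⟨mem_monics_of_degree_sub_lt hB ?_, by simpa using hP⟩
    rw [degree_sub_lt_comm]
    simp only [sub_sub_cancel]
    exact hP.trans_le (by exact_mod_cast hh)
  · intro P _; simp
  · intro P _; simp

/-- The number of pairs of representations whose values differ by a polynomial of degree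
less than `h`. -/
noncomputable def pairCount (γ : F) (n m h : ℕ) : ℕ :=
  ∑ p ∈ monics F n ×ˢ monics F m, ((monics F n ×ˢ monics F m).filter fun r =>
    ((p.1 ^ 2 + C γ * p.2 ^ 2) - (r.1 ^ 2 + C γ * r.2 ^ 2)).degree < (h : WithBot ℕ)).card

/-- Each pair has a monic value of degree `2 * n`, which lies within distance `h` of exactly `q ^ h`
centres. -/
theorem sum_intervalSum {n m h : ℕ} (hmn : m < n) (hh : h ≤ 2 * n) (γ : F) :
    ∑ A ∈ monics F (2 * n), intervalSum γ n m h A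
      = (Fintype.card F : ℝ) ^ (h + n + m) := by
  simp only [intervalSum_eq_card]
  rw [Finset.sum_comm]
  have : ∀ p ∈ monics F n ×ˢ monics F m, (∑ A ∈ monics F (2 * n),
      if (p.1 ^ 2 + C γ * p.2 ^ 2 - A).degree < (h : WithBot ℕ) then (1 : ℝ) else 0)
      = (Fintype.card F : ℝ) ^ h := by
    intro p hp
    rw [Finset.mem_product] at hp
    have := card_monics_near hh (sq_add_mem_monics hmn γ hp.1 hp.2)
    rw [Finset.sum_boole, this]
    push_cast; rfl
  rw [Finset.sum_congr rfl this, Finset.sum_const, Finset.card_product, card_monics, card_monics]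
  simp only [nsmul_eq_mul]
  push_cast
  ring

/-- By the ultrametric inequality, two values share all `q ^ h` of their nearby centres or none,
according to whether they are close to each other. -/
theorem sum_intervalSum_sq {n m h : ℕ} (hmn : m < n) (hh : h ≤ 2 * n) (γ : F) :
    ∑ A ∈ monics F (2 * n), intervalSum γ n m h A ^ 2
      = (Fintype.card F : ℝ) ^ h * pairCount γ n m h := by
  simp only [intervalSum_eq_card, pow_two (∑ p ∈ _, _), Finset.sum_mul_sum]
  rw [Finset.sum_comm, pairCount, Nat.cast_sum, Finset.mul_sum]
  refine Finset.sum_congr rfl fun p hp => ?_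
  rw [Finset.sum_comm, ← Finset.sum_boole, Finset.mul_sum]
  refine Finset.sum_congr rfl fun r _ => ?_
  rw [Finset.mem_product] at hp
  have hc := card_monics_near hh (sq_add_mem_monics hmn γ hp.1 hp.2)
  split_ifs with hpr
  · rw [mul_one, ← Nat.cast_pow, ← hc, ← Finset.sum_boole]
    refine Finset.sum_congr rfl fun A _ => ?_
    by_cases hA : (p.1 ^ 2 + C γ * p.2 ^ 2 - A).degree < (h : WithBot ℕ)
    · rw [if_pos hA, if_pos (degree_sub_lt_trans (degree_sub_lt_comm.1 hpr) hA), mul_one]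
    · rw [if_neg hA, zero_mul]
  · rw [mul_zero]
    refine Finset.sum_eq_zero fun A _ => ?_
    by_cases hA : (p.1 ^ 2 + C γ * p.2 ^ 2 - A).degree < (h : WithBot ℕ)
    · rw [if_neg (c := (r.1 ^ 2 + C γ * r.2 ^ 2 - A).degree < (h : WithBot ℕ)), mul_zero]
      exact fun hr => hpr (degree_sub_lt_trans hA (degree_sub_lt_comm.1 hr))
    · rw [if_neg hA, zero_mul]

theorem variance_eq {n m h : ℕ} (hmn : m < n) (hh : h ≤ 2 * n) (γ : F) :
    variance γ n m h = ((Fintype.card F : ℝ) ^ h * pairCount γ n m h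
      - (Fintype.card F : ℝ) ^ (2 * h + 2 * m)) / (Fintype.card F : ℝ) ^ (2 * n) := by
  have hq : (Fintype.card F : ℝ) ≠ 0 := by exact_mod_cast Fintype.card_ne_zero
  have hmean : mean γ n m h * (Fintype.card F : ℝ) ^ n = (Fintype.card F : ℝ) ^ (h + m) := by
    rw [mean, sum_intervalSum hmn hh]
    field_simp
    ring
  -- Kept as a quotient, since `h + m` may be less than `n`.
  have hmean' : mean γ n m h = (Fintype.card F : ℝ) ^ (h + m) / (Fintype.card F : ℝ) ^ n := by
    rw [← hmean]; field_simp
  rw [variance]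
  simp only [sub_sq, Finset.sum_add_distrib, Finset.sum_sub_distrib, ← Finset.sum_mul,
    ← Finset.mul_sum]
  rw [sum_intervalSum_sq hmn hh, sum_intervalSum hmn hh, Finset.sum_const, card_monics, hmean']
  simp only [nsmul_eq_mul]
  push_cast
  field_simp
  ring

end Basic

end TwoSquares

namespace TwoSquares

/-! ### Linearisation of the pair count, and the ranges where the kernel count is constant. -/

section Linear

variable {F : Type*} [Field F] [Fintype F]

/-- The number of pairs `(X, U)` of small degree with `X * Y + U * W` of degree less than `h`. -/
noncomputable def kerCount (n m h : ℕ) (Y W : F[X]) : ℕ :=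
  ((degLT F n ×ˢ degLT F m).filter fun p =>
    (p.1 * Y + p.2 * W).degree < (h : WithBot ℕ)).card

theorem sub_mem_degLT {n : ℕ} {P Q : F[X]} (hP : P ∈ monics F n) (hQ : Q ∈ monics F n) :
    P - Q ∈ degLT F n := by
  rw [mem_degLT, ← degree_of_mem_monics hP]
  refine degree_sub_lt_left ?_ (mem_monics.1 hP).1.ne_zero ?_
  · rw [degree_of_mem_monics hP, degree_of_mem_monics hQ]
  · rw [(mem_monics.1 hP).1, (mem_monics.1 hQ).1]

theorem add_mem_monics {n : ℕ} {P Q : F[X]} (hP : P ∈ monics F n) (hQ : Q ∈ degLT F n) :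
    P + Q ∈ monics F n :=
  mem_monics_of_degree_sub_lt hP (by simpa using hQ)

theorem C_mul_mem_degLT {n : ℕ} {P : F[X]} (a : F) (hP : P ∈ degLT F n) :
    C a * P ∈ degLT F n := by
  rw [mem_degLT] at hP ⊢
  rw [← smul_eq_C_mul]
  exact (degree_smul_le a P).trans_lt hP

/-- A difference of squares is twice the midpoint times the difference. Passing to midpoints and
differences is invertible because `2` is, and `γ` is absorbed into `U`. -/
theorem pairCount_eq {γ : F} (hγ : γ ≠ 0) (h2 : (2 : F) ≠ 0) (n m h : ℕ) :
    pairCount γ n m h = ∑ Y ∈ monics F n, ∑ W ∈ monics F m, kerCount n m h Y W := by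
  have hC2 : (C (2⁻¹ : F)) * 2 = 1 := by
    rw [show (2 : F[X]) = C 2 from (map_ofNat C 2).symm, ← C_mul, inv_mul_cancel₀ h2, C_1]
  have hCγ : C γ * C γ⁻¹ = 1 := by
    rw [← C_mul, mul_inv_cancel₀ hγ, C_1]
  have hdeg : ∀ {E G E' G' : F[X]},
      ((E ^ 2 + C γ * G ^ 2) - (E' ^ 2 + C γ * G' ^ 2)).degree < (h : WithBot ℕ) ↔
      ((E - E') * (E' + C 2⁻¹ * (E - E')) + C γ * (G - G') * (G' + C 2⁻¹ * (G - G'))).degree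
        < (h : WithBot ℕ) := by
    intro E G E' G'
    rw [← degree_C_mul (inv_ne_zero h2) (p := _ - _)]
    have : C 2⁻¹ * ((E ^ 2 + C γ * G ^ 2) - (E' ^ 2 + C γ * G' ^ 2)) =
        (E - E') * (E' + C 2⁻¹ * (E - E')) + C γ * (G - G') * (G' + C 2⁻¹ * (G - G')) := by
      linear_combination ((E - E') * E' + C γ * (G - G') * G') * hC2
    rw [this]
  have diff₁ : ∀ Y Z : F[X], (Y + C 2⁻¹ * Z) - (Y - C 2⁻¹ * Z) = Z := by
    intro Y Z
    linear_combination Z * hC2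
  have diff₂ : ∀ W U : F[X],
      C γ * ((W + C 2⁻¹ * (C γ⁻¹ * U)) - (W - C 2⁻¹ * (C γ⁻¹ * U))) = U := by
    intro W U
    linear_combination U * C γ * C γ⁻¹ * hC2 + U * hCγ
  have lift₁ : ∀ Y Z : F[X],
      (Y - C 2⁻¹ * Z) + C 2⁻¹ * ((Y + C 2⁻¹ * Z) - (Y - C 2⁻¹ * Z)) = Y := by
    intro Y Z
    linear_combination C 2⁻¹ * Z * hC2
  have lift₂ : ∀ W U : F[X], (W - C 2⁻¹ * (C γ⁻¹ * U)) + C 2⁻¹ *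
      ((W + C 2⁻¹ * (C γ⁻¹ * U)) - (W - C 2⁻¹ * (C γ⁻¹ * U))) = W :=
    fun W U => lift₁ W (C γ⁻¹ * U)
  simp only [pairCount, kerCount]
  rw [← Finset.sum_product', ← Finset.card_sigma, ← Finset.card_sigma]
  refine Finset.card_nbij'
    (fun x => ⟨(x.2.1 + C 2⁻¹ * (x.1.1 - x.2.1), x.2.2 + C 2⁻¹ * (x.1.2 - x.2.2)),
      (x.1.1 - x.2.1, C γ * (x.1.2 - x.2.2))⟩)
    (fun y => ⟨(y.1.1 + C 2⁻¹ * y.2.1, y.1.2 + C 2⁻¹ * (C γ⁻¹ * y.2.2)),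
      (y.1.1 - C 2⁻¹ * y.2.1, y.1.2 - C 2⁻¹ * (C γ⁻¹ * y.2.2))⟩) ?_ ?_ ?_ ?_
  · rintro ⟨⟨E, G⟩, ⟨E', G'⟩⟩ hx
    simp only [Finset.mem_coe, Finset.mem_sigma, Finset.mem_product, Finset.mem_filter] at hx ⊢
    obtain ⟨⟨hE, hG⟩, ⟨hE', hG'⟩, hx⟩ := hx
    exact ⟨⟨add_mem_monics hE' (C_mul_mem_degLT _ (sub_mem_degLT hE hE')),
      add_mem_monics hG' (C_mul_mem_degLT _ (sub_mem_degLT hG hG'))⟩,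
      ⟨sub_mem_degLT hE hE', C_mul_mem_degLT _ (sub_mem_degLT hG hG')⟩, hdeg.1 hx⟩
  · rintro ⟨⟨Y, W⟩, ⟨Z, U⟩⟩ hx
    simp only [Finset.mem_coe, Finset.mem_sigma, Finset.mem_product, Finset.mem_filter] at hx ⊢
    obtain ⟨⟨hY, hW⟩, ⟨hZ, hU⟩, hx⟩ := hx
    have hneg : ∀ {a : F} {P Q : F[X]}, P - C a * Q = P + C (-a) * Q := by
      intro a P Q; rw [C_neg]; ring
    refine ⟨⟨add_mem_monics hY (C_mul_mem_degLT _ hZ),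
      add_mem_monics hW (C_mul_mem_degLT _ (C_mul_mem_degLT _ hU))⟩, ⟨?_, ?_⟩, ?_⟩
    · rw [hneg]
      exact add_mem_monics hY (C_mul_mem_degLT _ hZ)
    · rw [hneg]
      exact add_mem_monics hW (C_mul_mem_degLT _ (C_mul_mem_degLT _ hU))
    · rw [hdeg, lift₁, lift₂, diff₁, diff₂]
      exact hx
  · rintro ⟨⟨E, G⟩, ⟨E', G'⟩⟩ _
    simp only [Sigma.mk.injEq, Prod.mk.injEq, heq_eq_eq]
    refine ⟨⟨?_, ?_⟩, ?_, ?_⟩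
    · linear_combination (E - E') * hC2
    · linear_combination (G - G') * hC2 + C 2⁻¹ * (G - G') * hCγ
    · ring
    · linear_combination -C 2⁻¹ * (G - G') * hCγ
  · rintro ⟨⟨Y, W⟩, ⟨Z, U⟩⟩ _
    simp only [Sigma.mk.injEq, Prod.mk.injEq, heq_eq_eq]
    exact ⟨⟨lift₁ Y Z, lift₂ W U⟩, diff₁ Y Z, diff₂ W U⟩

theorem card_degLT_mul_lt {k m h : ℕ} {W : F[X]} (hW : W ∈ monics F m) :
    ((degLT F k).filter fun U => (U * W).degree < (h : WithBot ℕ)).card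
      = Fintype.card F ^ min (h - m) k := by
  rw [← card_degLT]
  congr 1
  ext U
  rw [Finset.mem_filter, degree_mul_monic_lt hW]
  simp only [mem_degLT]
  rcases le_total (h - m) k with hle | hle
  · rw [min_eq_left hle]
    exact ⟨And.right, fun hU => ⟨hU.trans_le (by exact_mod_cast hle), hU⟩⟩
  · rw [min_eq_right hle]
    exact ⟨And.left, fun hU => ⟨hU, hU.trans_le (by exact_mod_cast hle)⟩⟩

theorem degree_add_lt_iff {F : Type*} [Field F] {P Q : F[X]} {h : WithBot ℕ} (hQ : Q.degree < h) :
    (P + Q).degree < h ↔ P.degree < h := by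
  constructor
  · intro hP
    rw [← add_sub_cancel_right P Q]
    exact (degree_sub_le _ _).trans_lt (max_lt hP hQ)
  · intro hP
    exact (degree_add_le _ _).trans_lt (max_lt hP hQ)

theorem degree_mul_lt_add {m k : ℕ} {U W : F[X]} (hW : W ∈ monics F m) (hU : U ∈ degLT F k) :
    (U * W).degree < ((k + m : ℕ) : WithBot ℕ) := by
  rw [degree_mul_monic_lt hW, Nat.add_sub_cancel]
  exact mem_degLT.1 hU

/-- The values `U` with `P + U * W` of degree less than `h` are a translate of those with
`U * W` of degree less than `h`, where `m ≤ h`. -/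
theorem card_filter_add_mul {m k h : ℕ} {P W : F[X]} (hW : W ∈ monics F m) (hmh : m ≤ h)
    (hhk : h ≤ m + k) (hP : P.degree < ((k + m : ℕ) : WithBot ℕ)) :
    ((degLT F k).filter fun U => (P + U * W).degree < (h : WithBot ℕ)).card
      = Fintype.card F ^ (h - m) := by
  have hWm := (mem_monics.1 hW).1
  have hr : (P %ₘ W).degree < (h : WithBot ℕ) := by
    refine (degree_modByMonic_lt P hWm).trans_le ?_
    rw [degree_of_mem_monics hW]
    exact_mod_cast hmh
  have hdiv : P = P %ₘ W + W * (P /ₘ W) := (modByMonic_add_div P W).symm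
  have hq : P /ₘ W ∈ degLT F k := by
    rw [mem_degLT, show k = k + m - m by omega, ← degree_mul_monic_lt hW]
    have : P /ₘ W * W = P + - (P %ₘ W) := by linear_combination - hdiv
    rw [this, degree_add_lt_iff]
    · exact hP
    · rw [degree_neg]
      exact hr.trans_le (by exact_mod_cast (by omega))
  -- The target is rewritten as the count for `P = 0`; translation by `P /ₘ W` then matches the two
  -- sets, as the remainder has degree less than `m ≤ h`.
  rw [← min_eq_left (show h - m ≤ k by omega), ← card_degLT_mul_lt hW]
  have key : ∀ U : F[X], (P + U * W).degree < (h : WithBot ℕ) ↔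
      ((U + P /ₘ W) * W).degree < (h : WithBot ℕ) := by
    intro U
    rw [← degree_add_lt_iff (P := (U + P /ₘ W) * W) hr]
    have : P + U * W = (U + P /ₘ W) * W + P %ₘ W := by linear_combination hdiv
    rw [this]
  refine Finset.card_nbij' (fun U => U + P /ₘ W) (fun U => U - P /ₘ W) ?_ ?_ ?_ ?_
  · intro U hU
    simp only [Finset.mem_coe, Finset.mem_filter, mem_degLT] at hU hq ⊢
    exact ⟨(degree_add_lt_iff hq).2 hU.1, (key U).1 hU.2⟩
  · intro U hU
    simp only [Finset.mem_coe, Finset.mem_filter, mem_degLT] at hU hq ⊢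
    refine ⟨(degree_sub_le _ _).trans_lt (max_lt hU.1 hq), (key _).2 ?_⟩
    rw [sub_add_cancel]
    exact hU.2
  · intro U _; simp
  · intro U _; simp

/-- Since `U * W` has degree less than `2 * m`, the product `X' * Y` has degree less than `max h (2
* m)`. -/
theorem mul_add_mul_degree_lt_imp {n m h : ℕ} {X' U Y W : F[X]} (hY : Y ∈ monics F n)
    (hW : W ∈ monics F m) (hU : U ∈ degLT F m) (h' : (X' * Y + U * W).degree < (h : WithBot ℕ)) :
    X' ∈ degLT F (max h (2 * m) - n) := by
  rw [mem_degLT, ← degree_mul_monic_lt hY]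
  have := degree_mul_lt_add hW hU
  rw [← degree_add_lt_iff (Q := U * W)]
  · exact h'.trans_le (by exact_mod_cast le_max_left _ _)
  · exact this.trans_le (by exact_mod_cast (by omega))

theorem kerCount_eq_sum (n m h : ℕ) (Y W : F[X]) :
    kerCount n m h Y W = ∑ X' ∈ degLT F n, ((degLT F m).filter fun U =>
      (X' * Y + U * W).degree < (h : WithBot ℕ)).card := by
  simp only [kerCount, Finset.card_filter]
  rw [Finset.sum_product]

theorem degLT_mono {a b : ℕ} (hab : a ≤ b) : degLT F a ⊆ degLT F b := by
  intro P hP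
  rw [mem_degLT] at hP ⊢
  exact hP.trans_le (by exact_mod_cast hab)

/-- Only the `X` of degree less than `max h (2 * m) - n` contribute. -/
theorem kerCount_eq_sum_degLT {n m h : ℕ} (hmn : m ≤ n) (hh : h ≤ 2 * n) {Y W : F[X]}
    (hY : Y ∈ monics F n) (hW : W ∈ monics F m) :
    kerCount n m h Y W = ∑ X' ∈ degLT F (max h (2 * m) - n), ((degLT F m).filter fun U =>
      (X' * Y + U * W).degree < (h : WithBot ℕ)).card := by
  rw [kerCount_eq_sum]
  symm
  refine Finset.sum_subset (degLT_mono (by omega)) fun P _ hP => ?_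
  rw [Finset.card_eq_zero, Finset.filter_eq_empty_iff]
  exact fun U hU h' => hP (mul_add_mul_degree_lt_imp hY hW hU h')

/-- Here `X = 0` is forced, leaving only the condition on `U * W`. -/
theorem kerCount_of_le_of_two_mul_le {n m h : ℕ} (hmn : 2 * m ≤ n) (hh : h ≤ n) {Y W : F[X]}
    (hY : Y ∈ monics F n) (hW : W ∈ monics F m) :
    kerCount n m h Y W = Fintype.card F ^ min (h - m) m := by
  rw [kerCount_eq_sum_degLT (by omega) (by omega) hY hW, show max h (2 * m) - n = 0 by omega]
  have : degLT F 0 = {0} := by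
    ext P
    simp [Nat.WithBot.lt_zero_iff]
  rw [this, Finset.sum_singleton]
  simp only [zero_mul, zero_add]
  exact card_degLT_mul_lt hW

/-- Here `U * W` is always small, so `U` is free and `X` is constrained by `Y` alone. -/
theorem kerCount_of_two_mul_le {n m h : ℕ} (hmn : m ≤ n) (hmh : 2 * m ≤ h)
    (hh : h ≤ 2 * n) {Y W : F[X]} (hY : Y ∈ monics F n) (hW : W ∈ monics F m) :
    kerCount n m h Y W = Fintype.card F ^ (h - n + m) := by
  rw [kerCount_eq_sum_degLT hmn hh hY hW, max_eq_left hmh, pow_add, ← card_degLT (h - n)]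
  refine Finset.sum_const_nat fun P hP => ?_
  rw [← card_degLT, Finset.filter_true_of_mem]
  intro U hU
  refine (degree_add_le _ _).trans_lt (max_lt ?_ ?_)
  · rw [degree_mul_monic_lt hY]
    exact mem_degLT.1 hP
  · exact (degree_mul_lt_add hW hU).trans_le (by exact_mod_cast (by omega))

/-- Every `X` of degree less than `2 * m - n` admits the same number `q ^ (h - m)` of `U`. -/
theorem kerCount_of_le_two_mul {n m h : ℕ} (hmn : m ≤ n) (hn : n ≤ 2 * m) (hmh : m ≤ h)
    (hh : h ≤ 2 * m) {Y W : F[X]} (hY : Y ∈ monics F n) (hW : W ∈ monics F m) :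
    kerCount n m h Y W = Fintype.card F ^ (m + h - n) := by
  rw [kerCount_eq_sum_degLT hmn (by omega) hY hW, max_eq_right hh,
    show m + h - n = 2 * m - n + (h - m) by omega, pow_add, ← card_degLT (2 * m - n)]
  refine Finset.sum_const_nat fun P hP => ?_
  refine card_filter_add_mul hW hmh (by omega) ?_
  have := degree_mul_lt_add hY hP
  rwa [show 2 * m - n + n = m + m by omega] at this

theorem pairCount_of_kerCount {γ : F} (hγ : γ ≠ 0) (h2 : (2 : F) ≠ 0) {n m h k : ℕ}
    (hk : ∀ Y ∈ monics F n, ∀ W ∈ monics F m, kerCount n m h Y W = Fintype.card F ^ k) :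
    pairCount γ n m h = Fintype.card F ^ (n + m + k) := by
  rw [pairCount_eq hγ h2, Finset.sum_congr rfl fun Y hY => Finset.sum_congr rfl (hk Y hY)]
  simp only [Finset.sum_const, card_monics, smul_eq_mul]
  ring

theorem variance_of_kerCount {γ : F} (hγ : γ ≠ 0) (h2 : (2 : F) ≠ 0) {n m h k : ℕ} (hmn : m < n)
    (hh : h ≤ 2 * n)
    (hk : ∀ Y ∈ monics F n, ∀ W ∈ monics F m, kerCount n m h Y W = Fintype.card F ^ k) :
    variance γ n m h = ((Fintype.card F : ℝ) ^ (h + n + m + k)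
      - (Fintype.card F : ℝ) ^ (2 * h + 2 * m)) / (Fintype.card F : ℝ) ^ (2 * n) := by
  rw [variance_eq hmn hh, pairCount_of_kerCount hγ h2 hk]
  push_cast
  ring

end Linear

end TwoSquares

namespace TwoSquares

/-! ### Monic gcds and division with remainder. -/

section Gcd

variable {F : Type*} [Field F]

open Classical in
/-- The monic greatest common divisor (zero if both polynomials vanish). -/
noncomputable def monicGcd (P Q : F[X]) : F[X] := normalize (EuclideanDomain.gcd P Q)

/-- Together with `exists_eq_monicGcd_mul`, this makes the splitting of a pair into its gcd and a
coprime pair unique. -/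
theorem monicGcd_mul {D P Q : F[X]} (hD : D.Monic) (h : IsCoprime P Q) :
    monicGcd (D * P) (D * Q) = D := by
  classical
  have key : Associated (EuclideanDomain.gcd (D * P) (D * Q)) D := by
    refine associated_of_dvd_dvd ?_ (EuclideanDomain.dvd_gcd (dvd_mul_right _ _)
      (dvd_mul_right _ _))
    obtain ⟨a, b, hab⟩ := h
    have : D = a * (D * P) + b * (D * Q) := by linear_combination - D * hab
    conv_rhs => rw [this]
    exact dvd_add (dvd_mul_of_dvd_right (EuclideanDomain.gcd_dvd_left _ _) _)
      (dvd_mul_of_dvd_right (EuclideanDomain.gcd_dvd_right _ _) _)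
  rw [monicGcd, normalize_eq_normalize_iff_associated.2 key, hD.normalize_eq_self]

theorem exists_eq_monicGcd_mul (P : F[X]) {Q : F[X]} (hQ : Q ≠ 0) :
    ∃ P' Q' : F[X], P = monicGcd P Q * P' ∧ Q = monicGcd P Q * Q' ∧
      (monicGcd P Q).Monic ∧ IsCoprime P' Q' := by
  classical
  have hg : EuclideanDomain.gcd P Q ≠ 0 := fun h => hQ (EuclideanDomain.gcd_eq_zero_iff.1 h).2
  have hm : (monicGcd P Q).Monic := monic_normalize hg
  obtain ⟨P', hP'⟩ : monicGcd P Q ∣ P :=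
    normalize_dvd_iff.2 (EuclideanDomain.gcd_dvd_left P Q)
  obtain ⟨Q', hQ'⟩ : monicGcd P Q ∣ Q :=
    normalize_dvd_iff.2 (EuclideanDomain.gcd_dvd_right P Q)
  refine ⟨P', Q', hP', hQ', hm, ?_⟩
  obtain ⟨c, hc⟩ : EuclideanDomain.gcd P Q ∣ monicGcd P Q := dvd_normalize_iff.2 dvd_rfl
  refine ⟨EuclideanDomain.gcdA P Q * c, EuclideanDomain.gcdB P Q * c, ?_⟩
  apply mul_left_cancel₀ hm.ne_zero
  have hb := EuclideanDomain.gcd_eq_gcd_ab P Q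
  linear_combination - EuclideanDomain.gcdA P Q * c * hP' - EuclideanDomain.gcdB P Q * c * hQ'
    - c * hb - hc

theorem monicGcd_C_mul {c : F} (hc : c ≠ 0) (P : F[X]) {Q : F[X]} (hQ : Q ≠ 0) :
    monicGcd (C c * P) Q = monicGcd P Q := by
  obtain ⟨P', Q', hP, hQ', hm, hco⟩ := exists_eq_monicGcd_mul P hQ
  set D := monicGcd P Q
  rw [hP, hQ', show C c * (D * P') = D * (C c * P') by ring]
  refine monicGcd_mul hm ?_
  exact (isCoprime_mul_unit_left_left (isUnit_C.2 hc.isUnit) P' Q').2 hco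

theorem monicGcd_zero {Q : F[X]} (hQ : Q.Monic) : monicGcd 0 Q = Q := by
  have := monicGcd_mul hQ (isCoprime_zero_left.2 isUnit_one)
  simpa using this

theorem mul_modByMonic_mul {D W : F[X]} (hD : D.Monic) (hW : W.Monic) (A : F[X]) :
    (D * A) %ₘ (D * W) = D * (A %ₘ W) := by
  refine (div_modByMonic_unique (A /ₘ W) _ (hD.mul hW) ⟨?_, ?_⟩).2
  · linear_combination D * modByMonic_add_div A W
  · rw [degree_mul, degree_mul, degree_eq_natDegree hD.ne_zero]
    exact WithBot.add_lt_add_left WithBot.coe_ne_bot (degree_modByMonic_lt A hW)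

theorem mul_modByMonic_modByMonic {W : F[X]} (hW : W.Monic) (A B : F[X]) :
    (A * (B %ₘ W)) %ₘ W = (A * B) %ₘ W := by
  refine ((div_modByMonic_unique ((A * B) /ₘ W - A * (B /ₘ W)) _ hW ⟨?_, ?_⟩).2)
  · linear_combination modByMonic_add_div (A * B) W - A * modByMonic_add_div B W
  · exact degree_modByMonic_lt _ hW

end Gcd

/-! ### Equidistribution of residues, and the reduction to a gcd sum. -/

section Residues

variable {F : Type*} [Field F] [Fintype F]

theorem modByMonic_mem_degLT {m : ℕ} {W : F[X]} (hW : W ∈ monics F m) (P : F[X]) :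
    P %ₘ W ∈ degLT F m := by
  rw [mem_degLT, ← degree_of_mem_monics hW]
  exact degree_modByMonic_lt P (mem_monics.1 hW).1

theorem div_mod_of_eq {m : ℕ} {W r : F[X]} (hW : W ∈ monics F m) (hr : r ∈ degLT F m) (Q : F[X]) :
    (Q * W + r) /ₘ W = Q ∧ (Q * W + r) %ₘ W = r := by
  refine div_modByMonic_unique Q r (mem_monics.1 hW).1 ⟨by ring, ?_⟩
  rw [degree_of_mem_monics hW]
  exact mem_degLT.1 hr

/-- Polynomials of degree less than `d + m` are equidistributed modulo `W`. -/
theorem sum_degLT_modByMonic {M : Type*} [AddCommMonoid M] {m : ℕ} (d : ℕ) {W : F[X]}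
    (hW : W ∈ monics F m) (f : F[X] → M) :
    ∑ Z ∈ degLT F (d + m), f (Z %ₘ W) = Fintype.card F ^ d • ∑ r ∈ degLT F m, f r := by
  rw [← card_degLT, ← Finset.sum_const, ← Finset.sum_product']
  refine Finset.sum_nbij' (fun Z => (Z /ₘ W, Z %ₘ W)) (fun p => p.1 * W + p.2) ?_ ?_ ?_ ?_ ?_
  · intro Z hZ
    have hr := modByMonic_mem_degLT hW Z
    refine Finset.mem_product.2 ⟨?_, hr⟩
    simp only [mem_degLT] at hZ hr ⊢
    have : Z /ₘ W * W = Z + - (Z %ₘ W) := by linear_combination modByMonic_add_div Z W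
    rw [show d = d + m - m by omega, ← degree_mul_monic_lt hW, this, degree_add_lt_iff]
    · exact hZ
    · rw [degree_neg]
      exact hr.trans_le (by exact_mod_cast (by omega))
  · intro p hp
    rw [Finset.mem_product] at hp
    rw [mem_degLT, degree_add_lt_iff]
    · exact degree_mul_lt_add hW hp.1
    · exact (mem_degLT.1 hp.2).trans_le (by exact_mod_cast (by omega))
  · intro Z _
    simp only
    linear_combination modByMonic_add_div Z W
  · intro p hp
    rw [Finset.mem_product] at hp
    have := div_mod_of_eq hW hp.2 p.1
    exact Prod.ext this.1 this.2
  · intro Z _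
    rfl

/-- Monic polynomials of degree at least `m` are equidistributed modulo `W`. -/
theorem sum_monics_modByMonic {M : Type*} [AddCommMonoid M] {m : ℕ} (d : ℕ) {W : F[X]}
    (hW : W ∈ monics F m) (f : F[X] → M) :
    ∑ Z ∈ monics F (d + m), f (Z %ₘ W) = Fintype.card F ^ d • ∑ r ∈ degLT F m, f r := by
  rw [← card_monics, ← Finset.sum_const, ← Finset.sum_product']
  have hmul : ∀ {Q : F[X]}, (Q * W ∈ monics F (d + m) ↔ Q ∈ monics F d) := by
    intro Q
    obtain ⟨hm, hd⟩ := mem_monics.1 hW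
    rw [mem_monics, mem_monics]
    refine ⟨fun ⟨hQW, hdeg⟩ => ?_, fun ⟨hQ, hdeg⟩ => ⟨hQ.mul hm, ?_⟩⟩
    · have hQ := hm.of_mul_monic_right hQW
      rw [hQ.natDegree_mul hm, hd] at hdeg
      exact ⟨hQ, by omega⟩
    · rw [hQ.natDegree_mul hm, hd, hdeg]
  refine Finset.sum_nbij' (fun Z => (Z /ₘ W, Z %ₘ W)) (fun p => p.1 * W + p.2) ?_ ?_ ?_ ?_ ?_
  · intro Z hZ
    have hr := modByMonic_mem_degLT hW Z
    refine Finset.mem_product.2 ⟨?_, hr⟩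
    rw [← hmul]
    refine mem_monics_of_degree_sub_lt hZ ?_
    have : Z /ₘ W * W - Z = - (Z %ₘ W) := by linear_combination modByMonic_add_div Z W
    rw [this, degree_neg]
    exact (mem_degLT.1 hr).trans_le (by exact_mod_cast (by omega))
  · intro p hp
    rw [Finset.mem_product] at hp
    exact add_mem_monics (hmul.2 hp.1) (degLT_mono (by omega) hp.2)
  · intro Z _
    simp only
    linear_combination modByMonic_add_div Z W
  · intro p hp
    rw [Finset.mem_product] at hp
    have := div_mod_of_eq hW hp.2 p.1
    exact Prod.ext this.1 this.2
  · intro Z _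
    rfl

/-- Multiplication by a unit permutes the residues modulo `W`. -/
theorem sum_degLT_mul_modByMonic {M : Type*} [AddCommMonoid M] {m : ℕ} {A W : F[X]}
    (hW : W ∈ monics F m) (hA : IsCoprime A W) (f : F[X] → M) :
    ∑ r ∈ degLT F m, f ((A * r) %ₘ W) = ∑ r ∈ degLT F m, f r := by
  have hm := (mem_monics.1 hW).1
  obtain ⟨u, v, huv⟩ := hA
  have hinv : ∀ r ∈ degLT F m, ∀ B C' : F[X], (∃ v, B * C' + v * W = 1) →
      (B * ((C' * r) %ₘ W)) %ₘ W = r := by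
    rintro r hr B C' ⟨v, hv⟩
    rw [mul_modByMonic_modByMonic hm]
    have := (div_mod_of_eq hW hr (-v * r)).2
    rwa [show -v * r * W + r = B * (C' * r) by linear_combination - r * hv] at this
  refine Finset.sum_nbij' (fun r => (A * r) %ₘ W) (fun r => (u * r) %ₘ W)
    (fun r _ => modByMonic_mem_degLT hW _) (fun r _ => modByMonic_mem_degLT hW _) ?_ ?_ ?_
  · exact fun r hr => hinv r hr u A ⟨v, huv⟩
  · exact fun r hr => hinv r hr A u ⟨v, by linear_combination huv⟩
  · exact fun r _ => rfl

theorem degree_monic_mul_lt {P D : F[X]} {d h : ℕ} (hD : D ∈ monics F d) :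
    (D * P).degree < (h : WithBot ℕ) ↔ P.degree < ((h - d : ℕ) : WithBot ℕ) := by
  rw [mul_comm, degree_mul_monic_lt hD]

/-- The number of residues `r` modulo `W` for which `P * r` has a small residue. -/
theorem card_mul_modByMonic_lt {m h : ℕ} (hh : h ≤ m) (P : F[X]) {W : F[X]}
    (hW : W ∈ monics F m) :
    ((degLT F m).filter fun r => ((P * r) %ₘ W).degree < (h : WithBot ℕ)).card
      = Fintype.card F ^ max h (monicGcd P W).natDegree := by
  obtain ⟨hWm, hWd⟩ := mem_monics.1 hW
  obtain ⟨P', W', hP, hW', hD, hco⟩ := exists_eq_monicGcd_mul P hWm.ne_zero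
  set D := monicGcd P W
  have hW'm : W'.Monic := hD.of_mul_monic_left (hW' ▸ hWm)
  have hdeg : D.natDegree + W'.natDegree = m := by
    rw [← hWd, hW', hD.natDegree_mul hW'm]
  have hDmem : D ∈ monics F D.natDegree := mem_monics.2 ⟨hD, rfl⟩
  have hWmem : W' ∈ monics F W'.natDegree := mem_monics.2 ⟨hW'm, rfl⟩
  -- Cancelling the gcd `D` reduces to multiplication by the unit `P'` modulo `W'`; each residue
  -- modulo `W'` has `q ^ deg D` lifts.
  have hiff : ∀ r, ((P * r) %ₘ W).degree < (h : WithBot ℕ) ↔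
      ((P' * (r %ₘ W')) %ₘ W').degree < ((h - D.natDegree : ℕ) : WithBot ℕ) := by
    intro r
    rw [mul_modByMonic_modByMonic hW'm, ← degree_monic_mul_lt hDmem,
      ← mul_modByMonic_mul hD hW'm, ← hW', ← mul_assoc, ← hP]
  simp only [hiff]
  rw [Finset.card_filter, ← hdeg, sum_degLT_modByMonic _ hWmem (fun r =>
    if ((P' * r) %ₘ W').degree < ((h - D.natDegree : ℕ) : WithBot ℕ) then 1 else 0),
    sum_degLT_mul_modByMonic hWmem hco (fun r =>
    if r.degree < ((h - D.natDegree : ℕ) : WithBot ℕ) then 1 else 0), ← Finset.card_filter]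
  have : (degLT F W'.natDegree).filter
      (fun r => r.degree < ((h - D.natDegree : ℕ) : WithBot ℕ)) = degLT F (h - D.natDegree) := by
    ext r
    rw [Finset.mem_filter, mem_degLT, mem_degLT]
    exact ⟨And.right, fun hr => ⟨hr.trans_le (by exact_mod_cast (by omega)), hr⟩⟩
  rw [this, card_degLT, smul_eq_mul, ← pow_add]
  -- With truncated subtraction, `deg D + (h - deg D) = max h (deg D)`.
  congr 1
  omega

/-- Exactly one `U` brings the degree below `m`, and for it the sum is the remainder `P %ₘ W`; only
the size of this remainder is left to test. -/
theorem card_filter_add_mul_of_le {m h : ℕ} (hh : h ≤ m) {P W : F[X]} (hW : W ∈ monics F m)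
    (hP : P.degree < ((m + m : ℕ) : WithBot ℕ)) :
    ((degLT F m).filter fun U => (P + U * W).degree < (h : WithBot ℕ)).card
      = if (P %ₘ W).degree < (h : WithBot ℕ) then 1 else 0 := by
  have hle := card_filter_add_mul hW le_rfl (by omega) hP
  have hWm := (mem_monics.1 hW).1
  rw [Nat.sub_self, pow_zero, Finset.card_eq_one] at hle
  obtain ⟨V, hV⟩ := hle
  have hmem := Finset.mem_filter.1 (hV ▸ Finset.mem_singleton_self V)
  have hmod : P %ₘ W = P + V * W := by
    have := (div_mod_of_eq hW (mem_degLT.2 hmem.2) (-V)).2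
    rwa [show -V * W + (P + V * W) = P by ring] at this
  have huniq : ∀ U ∈ degLT F m, (P + U * W).degree < (h : WithBot ℕ) → U = V := by
    intro U hU h'
    rw [← Finset.mem_singleton, ← hV, Finset.mem_filter]
    exact ⟨hU, h'.trans_le (by exact_mod_cast hh)⟩
  rw [hmod]
  split_ifs with hlt
  · rw [Finset.card_eq_one]
    refine ⟨V, ?_⟩
    ext U
    rw [Finset.mem_filter, Finset.mem_singleton]
    refine ⟨fun hU => huniq U hU.1 hU.2, ?_⟩
    rintro rfl
    exact ⟨hmem.1, hlt⟩
  · rw [Finset.card_eq_zero, Finset.filter_eq_empty_iff]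
    intro U hU h'
    rw [huniq U hU h'] at h'
    exact hlt h'

/-- The sum over `Y` is taken innermost: as `n ≥ m`, each residue modulo `W` is hit `q ^ (n - m)`
times. -/
theorem pairCount_eq_sum_gcd {γ : F} (hγ : γ ≠ 0) (h2 : (2 : F) ≠ 0) {n m h : ℕ} (hmn : m ≤ n)
    (hn : n ≤ 2 * m) (hh : h ≤ m) :
    pairCount γ n m h = Fintype.card F ^ (n - m) * ∑ P ∈ degLT F (2 * m - n),
      ∑ W ∈ monics F m, Fintype.card F ^ max h (monicGcd P W).natDegree := by
  have hker : ∀ Y ∈ monics F n, ∀ W ∈ monics F m, kerCount n m h Y W =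
      ∑ P ∈ degLT F (2 * m - n), if ((P * (Y %ₘ W)) %ₘ W).degree < (h : WithBot ℕ)
        then 1 else 0 := by
    intro Y hY W hW
    rw [kerCount_eq_sum_degLT hmn (by omega) hY hW, max_eq_right (by omega)]
    refine Finset.sum_congr rfl fun P hP => ?_
    have := degree_mul_lt_add hY hP
    rw [show 2 * m - n + n = m + m by omega] at this
    rw [card_filter_add_mul_of_le hh hW this, mul_modByMonic_modByMonic (mem_monics.1 hW).1]
  rw [pairCount_eq hγ h2, Finset.sum_congr rfl fun Y hY => Finset.sum_congr rfl (hker Y hY),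
    Finset.sum_comm, Finset.sum_comm (s := degLT F (2 * m - n)), Finset.mul_sum]
  refine Finset.sum_congr rfl fun W hW => ?_
  rw [Finset.sum_comm, Finset.mul_sum]
  refine Finset.sum_congr rfl fun P _ => ?_
  have := sum_monics_modByMonic (n - m) hW (fun r =>
    if ((P * r) %ₘ W).degree < (h : WithBot ℕ) then 1 else 0)
  rw [Nat.sub_add_cancel hmn] at this
  rw [this, ← Finset.card_filter, card_mul_modByMonic_lt hh P hW, smul_eq_mul]

end Residues

end TwoSquares

namespace TwoSquares

/-! ### Evaluation of the gcd sums. -/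

section GcdSums

variable {F : Type*} [Field F] [Fintype F]

open Classical in
/-- The number of coprime pairs of monic polynomials of degrees `e` and `f`. -/
noncomputable def coprimeCount (F : Type*) [Field F] [Finite F] (e f : ℕ) : ℕ :=
  ((monics F e ×ˢ monics F f).filter fun p => IsCoprime p.1 p.2).card

/-- The sum of `φ (deg (gcd P Q))` over monic `P`, `Q` of degrees `e` and `f`. -/
noncomputable def gcdSum (F : Type*) [Field F] [Finite F] (φ : ℕ → ℝ) (e f : ℕ) : ℝ :=
  ∑ P ∈ monics F e, ∑ Q ∈ monics F f, φ (monicGcd P Q).natDegree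

/-- Pairs are sorted by their gcd: `q ^ d` choices of degree `d`, times the coprime pairs of
cofactors. -/
theorem gcdSum_eq (φ : ℕ → ℝ) {e f : ℕ} (hef : e ≤ f) :
    gcdSum F φ e f = ∑ d ∈ Finset.range (e + 1),
      (Fintype.card F : ℝ) ^ d * coprimeCount F (e - d) (f - d) * φ d := by
  classical
  have hterm : ∀ d, (Fintype.card F : ℝ) ^ d * coprimeCount F (e - d) (f - d) * φ d =
      ∑ _x ∈ monics F d ×ˢ ((monics F (e - d) ×ˢ monics F (f - d)).filter
        fun p => IsCoprime p.1 p.2), φ d := by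
    intro d
    rw [Finset.sum_const, Finset.card_product, card_monics, nsmul_eq_mul, coprimeCount]
    push_cast
    rfl
  rw [gcdSum, ← Finset.sum_product', Finset.sum_congr rfl fun d _ => hterm d,
    Finset.sum_sigma']
  symm
  refine Finset.sum_bij (fun x _ => (x.2.1 * x.2.2.1, x.2.1 * x.2.2.2)) ?_ ?_ ?_ ?_
  · rintro ⟨d, D, P, Q⟩ hx
    simp only [Finset.mem_sigma, Finset.mem_range, Finset.mem_product, Finset.mem_filter,
      mem_monics] at hx ⊢
    obtain ⟨hd, ⟨hD, rfl⟩, ⟨⟨hP, hPd⟩, hQ, hQd⟩, -⟩ := hx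
    refine ⟨⟨hD.mul hP, ?_⟩, hD.mul hQ, ?_⟩
    · rw [hD.natDegree_mul hP, hPd]; omega
    · rw [hD.natDegree_mul hQ, hQd]; omega
  · rintro ⟨d, D, P, Q⟩ hx ⟨d', D', P', Q'⟩ hx' heq
    simp only [Finset.mem_sigma, Finset.mem_range, Finset.mem_product, Finset.mem_filter,
      mem_monics] at hx hx'
    obtain ⟨-, ⟨hD, rfl⟩, -, hco⟩ := hx
    obtain ⟨-, ⟨hD', rfl⟩, -, hco'⟩ := hx'
    obtain ⟨h1, h2⟩ := Prod.mk.inj heq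
    simp only at h1 h2
    have hDD : D = D' := by rw [← monicGcd_mul hD hco, h1, h2, monicGcd_mul hD' hco']
    subst hDD
    rw [mul_left_cancel₀ hD.ne_zero h1, mul_left_cancel₀ hD.ne_zero h2]
  · rintro ⟨P, Q⟩ hx
    simp only [Finset.mem_product, mem_monics] at hx
    obtain ⟨⟨hP, hPd⟩, hQ, hQd⟩ := hx
    obtain ⟨P', Q', hP', hQ', hD, hco⟩ := exists_eq_monicGcd_mul P hQ.ne_zero
    have hPm : P'.Monic := hD.of_mul_monic_left (hP' ▸ hP)
    have hQm : Q'.Monic := hD.of_mul_monic_left (hQ' ▸ hQ)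
    have h1 := congrArg natDegree hP'
    have h2 := congrArg natDegree hQ'
    rw [hD.natDegree_mul hPm] at h1
    rw [hD.natDegree_mul hQm] at h2
    refine ⟨⟨(monicGcd P Q).natDegree, monicGcd P Q, P', Q'⟩, ?_, ?_⟩
    · simp only [Finset.mem_sigma, Finset.mem_range, Finset.mem_product, Finset.mem_filter,
        mem_monics]
      exact ⟨by omega, ⟨hD, trivial⟩, ⟨⟨hPm, by omega⟩, hQm, by omega⟩, hco⟩
    · exact Prod.ext hP'.symm hQ'.symm
  · rintro ⟨d, D, P, Q⟩ hx
    simp only [Finset.mem_sigma, Finset.mem_range, Finset.mem_product, Finset.mem_filter,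
      mem_monics] at hx
    obtain ⟨-, ⟨hD, rfl⟩, -, hco⟩ := hx
    simp only
    rw [monicGcd_mul hD hco]

theorem gcdSum_zero (φ : ℕ → ℝ) (f : ℕ) :
    gcdSum F φ 0 f = (Fintype.card F : ℝ) ^ f * φ 0 := by
  classical
  have : coprimeCount F 0 f = Fintype.card F ^ f := by
    rw [coprimeCount, Finset.filter_true_of_mem, Finset.card_product, card_monics, card_monics,
      pow_zero, one_mul]
    intro p hp
    obtain ⟨hm, hd⟩ := mem_monics.1 (Finset.mem_product.1 hp).1
    rw [hm.natDegree_eq_zero.1 hd]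
    exact isCoprime_one_left
  rw [gcdSum_eq φ (Nat.zero_le f)]
  simp [this]

theorem gcdSum_one (e f : ℕ) :
    gcdSum F (fun _ => 1) e f = (Fintype.card F : ℝ) ^ (e + f) := by
  simp only [gcdSum, Finset.sum_const, card_monics, nsmul_eq_mul]
  push_cast
  ring

theorem gcdSum_succ_succ_aux (φ : ℕ → ℝ) {e f : ℕ} (hef : e ≤ f) :
    gcdSum F φ (e + 1) (f + 1) = coprimeCount F (e + 1) (f + 1) * φ 0
      + Fintype.card F * gcdSum F (fun d => φ (d + 1)) e f := by
  rw [gcdSum_eq φ (by omega), gcdSum_eq _ hef, Finset.sum_range_succ', Finset.mul_sum, add_comm]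
  congr 1
  · simp
  · refine Finset.sum_congr rfl fun d _ => ?_
    rw [Nat.add_sub_add_right, Nat.add_sub_add_right]
    ring

/-- Taking the constant weight `1`, whose sum is known, determines the number of coprime pairs in
the recursion. -/
theorem gcdSum_succ_succ (φ : ℕ → ℝ) {e f : ℕ} (hef : e ≤ f) :
    gcdSum F φ (e + 1) (f + 1) =
      ((Fintype.card F : ℝ) ^ (e + f + 2) - (Fintype.card F : ℝ) ^ (e + f + 1)) * φ 0
      + Fintype.card F * gcdSum F (fun d => φ (d + 1)) e f := by
  have h1 := gcdSum_succ_succ_aux (F := F) (fun _ => 1) hef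
  rw [gcdSum_one, gcdSum_one] at h1
  have h2 : (coprimeCount F (e + 1) (f + 1) : ℝ)
      = (Fintype.card F : ℝ) ^ (e + f + 2) - (Fintype.card F : ℝ) ^ (e + f + 1) := by
    linear_combination - h1
  rw [gcdSum_succ_succ_aux φ hef, h2]

theorem gcdSum_const_mul (c : ℝ) (φ : ℕ → ℝ) (e f : ℕ) :
    gcdSum F (fun d => c * φ d) e f = c * gcdSum F φ e f := by
  simp only [gcdSum, Finset.mul_sum]

theorem gcdSum_pow_max (h : ℕ) {e f : ℕ} (hef : e ≤ f) :
    gcdSum F (fun d => (Fintype.card F : ℝ) ^ max h d) e f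
      = (Fintype.card F : ℝ) ^ (h + e + f)
        + (e - h : ℕ) * ((Fintype.card F : ℝ) - 1) * (Fintype.card F : ℝ) ^ (e + f - 1) := by
  induction e generalizing h f with
  | zero =>
    rw [gcdSum_zero]
    simp
    ring
  | succ e ih =>
    obtain ⟨f, rfl⟩ : ∃ g, f = g + 1 := ⟨f - 1, by omega⟩
    have hef' : e ≤ f := by omega
    -- Valid also for `h = 0`, where `h - 1` truncates to `0`.
    have hshift : (fun d => (Fintype.card F : ℝ) ^ max h (d + 1)) =
        fun d => Fintype.card F * (Fintype.card F : ℝ) ^ max (h - 1) d := by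
      funext d
      rw [← pow_succ']
      congr 1
      omega
    rw [gcdSum_succ_succ _ hef', hshift, gcdSum_const_mul, ih _ hef']
    rcases h with _ | h
    · rcases Nat.eq_zero_or_pos (e + f) with h0 | h0
      · obtain ⟨rfl, rfl⟩ : e = 0 ∧ f = 0 := by omega
        simp
        ring
      · obtain ⟨k, hk⟩ : ∃ k, e + f = k + 1 := ⟨e + f - 1, by omega⟩
        simp only [Nat.zero_sub, Nat.sub_zero, zero_add, max_self, pow_zero,
          show e + 1 + (f + 1) = k + 3 by omega, hk]
        simp only [show k + 3 - 1 = k + 2 by omega, show k + 1 - 1 = k by omega]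
        push_cast
        ring
    · rw [Nat.add_sub_cancel, Nat.add_sub_add_right, max_eq_left (Nat.zero_le _)]
      rcases Nat.eq_zero_or_pos (e - h) with h0 | h0
      · rw [h0]
        push_cast
        ring
      · obtain ⟨k, hk⟩ : ∃ k, e + f = k + 1 := ⟨e + f - 1, by omega⟩
        simp only [show e + 1 + (f + 1) - 1 = k + 2 by omega,
          show h + 1 + (e + 1) + (f + 1) = h + k + 4 by omega, hk,
          show h + e + f = h + k + 1 by omega]
        push_cast
        ring

/-- A polynomial of degree exactly `a` is uniquely a nonzero constant times a monic one. -/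
theorem sum_degLT_succ {M : Type*} [AddCommMonoid M] (a : ℕ) (f : F[X] → M)
    (hf : ∀ c : F, c ≠ 0 → ∀ P, f (C c * P) = f P) :
    ∑ P ∈ degLT F (a + 1), f P = ∑ P ∈ degLT F a, f P
      + (Fintype.card F - 1) • ∑ P ∈ monics F a, f P := by
  classical
  rw [← Finset.sum_filter_add_sum_filter_not (degLT F (a + 1)) (· ∈ degLT F a)]
  congr 1
  · rw [Finset.filter_mem_eq_inter, Finset.inter_eq_right.2 (degLT_mono (Nat.le_succ a))]
  · have hcard : ((Finset.univ : Finset F).erase 0).card = Fintype.card F - 1 := by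
      rw [Finset.card_erase_of_mem (Finset.mem_univ _), Finset.card_univ]
    rw [← hcard, ← Finset.sum_const, ← Finset.sum_product']
    symm
    have hmem : ∀ {P : F[X]}, P ∈ degLT F (a + 1) ∧ P ∉ degLT F a ↔
        P ≠ 0 ∧ P.natDegree = a := by
      intro P
      rw [mem_degLT, mem_degLT]
      by_cases hP : P = 0
      · simp [hP]
      · rw [degree_eq_natDegree hP, Nat.cast_lt, Nat.cast_lt]
        simp only [ne_eq, hP, not_false_eq_true, true_and]
        omega
    refine Finset.sum_nbij' (fun p => C p.1 * p.2)
      (fun P => (P.leadingCoeff, C P.leadingCoeff⁻¹ * P)) ?_ ?_ ?_ ?_ ?_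
    · rintro ⟨c, P⟩ hp
      simp only [Finset.mem_product, Finset.mem_erase, Finset.mem_univ, and_true,
        mem_monics] at hp
      obtain ⟨hc, hP, hPd⟩ := hp
      rw [Finset.mem_filter, hmem]
      exact ⟨mul_ne_zero (C_ne_zero.2 hc) hP.ne_zero, by rw [natDegree_C_mul hc, hPd]⟩
    · intro P hP
      rw [Finset.mem_filter, hmem] at hP
      have hl := leadingCoeff_ne_zero.2 hP.1
      rw [Finset.mem_product, mem_monics]
      refine ⟨by simpa using hP.1, ?_, ?_⟩
      · rw [Monic, leadingCoeff_mul, leadingCoeff_C, inv_mul_cancel₀ hl]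
      · rw [natDegree_C_mul (inv_ne_zero hl), hP.2]
    · rintro ⟨c, P⟩ hp
      simp only [Finset.mem_product, Finset.mem_erase, Finset.mem_univ, and_true,
        mem_monics] at hp
      obtain ⟨hc, hP, hPd⟩ := hp
      have hl : (C c * P).leadingCoeff = c := by
        rw [leadingCoeff_mul, leadingCoeff_C, hP, mul_one]
      simp only [hl]
      rw [← mul_assoc, ← C_mul, inv_mul_cancel₀ hc, C_1, one_mul]
    · intro P hP
      rw [Finset.mem_filter, hmem] at hP
      have hl := leadingCoeff_ne_zero.2 hP.1
      simp only
      rw [← mul_assoc, ← C_mul, mul_inv_cancel₀ hl, C_1, one_mul]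
    · rintro ⟨c, P⟩ hp
      simp only [Finset.mem_product, Finset.mem_erase, Finset.mem_univ, and_true] at hp
      exact (hf c hp.1 P).symm

/-- The sum of `q ^ max h (deg (gcd P W))` over all `P` of degree less than `a` and all monic
`W` of degree `m`. -/
noncomputable def smallGcdSum (F : Type*) [Field F] [Fintype F] (h m a : ℕ) : ℝ :=
  ∑ P ∈ degLT F a, ∑ W ∈ monics F m, (Fintype.card F : ℝ) ^ max h (monicGcd P W).natDegree

/-- Only `P = 0` occurs, and its gcd with `W` is `W` itself. -/
theorem smallGcdSum_zero {h m : ℕ} (hh : h ≤ m) :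
    smallGcdSum F h m 0 = (Fintype.card F : ℝ) ^ (m + m) := by
  have h0 : degLT F 0 = {0} := by
    ext P
    simp [Nat.WithBot.lt_zero_iff]
  rw [smallGcdSum, h0, Finset.sum_singleton]
  have : ∀ W ∈ monics F m, (Fintype.card F : ℝ) ^ max h (monicGcd 0 W).natDegree
      = (Fintype.card F : ℝ) ^ m := by
    intro W hW
    obtain ⟨hm, hd⟩ := mem_monics.1 hW
    rw [monicGcd_zero hm, hd, max_eq_right hh]
  rw [Finset.sum_congr rfl this, Finset.sum_const, card_monics, nsmul_eq_mul]
  push_cast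
  ring

theorem smallGcdSum_succ (h : ℕ) {m a : ℕ} (ha : a ≤ m) :
    smallGcdSum F h m (a + 1) = smallGcdSum F h m a + ((Fintype.card F : ℝ) - 1) *
      ((Fintype.card F : ℝ) ^ (h + a + m)
        + (a - h : ℕ) * ((Fintype.card F : ℝ) - 1) * (Fintype.card F : ℝ) ^ (a + m - 1)) := by
  rw [smallGcdSum, sum_degLT_succ, ← gcdSum_pow_max h ha, nsmul_eq_mul,
    Nat.cast_sub Fintype.card_pos, Nat.cast_one]
  · rfl
  · intro c hc P
    refine Finset.sum_congr rfl fun W hW => ?_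
    rw [monicGcd_C_mul hc P (mem_monics.1 hW).1.ne_zero]

theorem smallGcdSum_of_le {h m a : ℕ} (hh : h ≤ m) (ha : a ≤ h) :
    smallGcdSum F h m a = (Fintype.card F : ℝ) ^ (m + m) + (Fintype.card F : ℝ) ^ (h + m + a)
      - (Fintype.card F : ℝ) ^ (h + m) := by
  induction a with
  | zero => rw [smallGcdSum_zero hh]; ring
  | succ a ih =>
    rw [smallGcdSum_succ h (by omega), ih (by omega), Nat.sub_eq_zero_of_le (by omega)]
    push_cast
    ring

/-- Each degree from `h` up to `h + k - 1` adds a truncated difference `a - h`, now nonzero beyond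
`a = h`. The use of `m + 1` avoids a truncated exponent `m - 1`. -/
theorem smallGcdSum_add {h m k : ℕ} (hk : h + k ≤ m + 1) :
    smallGcdSum F h (m + 1) (h + k) = (Fintype.card F : ℝ) ^ (m + 1 + (m + 1))
      + (Fintype.card F : ℝ) ^ (h + (m + 1) + (h + k)) - (Fintype.card F : ℝ) ^ (m + 1 + (h + k))
      + k * ((Fintype.card F : ℝ) - 1) * (Fintype.card F : ℝ) ^ (m + (h + k)) := by
  induction k with
  | zero =>
    rw [add_zero, smallGcdSum_of_le (by omega) le_rfl, add_comm h (m + 1)]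
    push_cast
    ring
  | succ k ih =>
    rw [← add_assoc, smallGcdSum_succ h (by omega), ih (by omega), Nat.add_sub_cancel_left,
      show h + k + (m + 1) - 1 = h + k + m by omega]
    push_cast
    ring

theorem pairCount_eq_smallGcdSum {γ : F} (hγ : γ ≠ 0) (h2 : (2 : F) ≠ 0) {n m h : ℕ}
    (hmn : m ≤ n) (hn : n ≤ 2 * m) (hh : h ≤ m) :
    (pairCount γ n m h : ℝ)
      = (Fintype.card F : ℝ) ^ (n - m) * smallGcdSum F h m (2 * m - n) := by
  rw [pairCount_eq_sum_gcd hγ h2 hmn hn hh, smallGcdSum]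
  push_cast
  rfl

end GcdSums

end TwoSquares

/-! ### Assembly of the cases. -/

theorem theorem1 {F : Type*} [Field F] [Fintype F] (q : ℕ) (hq : Fintype.card F = q)
    (hodd : Odd q) (γ : F) (hγ : γ ≠ 0) (n m h : ℕ) (hh : h ≤ 2 * n) :
    (1 ≤ m → m + 1 ≤ n → n + 1 ≤ 2 * m →
      (m ≤ h → TwoSquares.variance γ n m h = 0) ∧
      (2 * m ≤ n + h → h + 1 ≤ m →
        TwoSquares.variance γ n m h
          = (q : ℝ) ^ h / (q : ℝ) ^ n * ((q : ℝ) ^ m - (q : ℝ) ^ h)) ∧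
      (h + n + 1 ≤ 2 * m →
        TwoSquares.variance γ n m h
          = (q : ℝ) ^ (m + h) / (q : ℝ) ^ (2 * n) *
            ((q : ℝ) ^ n - (q : ℝ) ^ m
              + (2 * (m : ℝ) - (n : ℝ) - (h : ℝ)) * ((q : ℝ) - 1) * (q : ℝ) ^ (m - 1)))) ∧
    (1 ≤ m → n = 2 * m →
      (m ≤ h → TwoSquares.variance γ n m h = 0) ∧
      (h + 1 ≤ m →
        TwoSquares.variance γ n m h
          = (q : ℝ) ^ h / (q : ℝ) ^ n * ((q : ℝ) ^ m - (q : ℝ) ^ h))) ∧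
    (1 ≤ m → 2 * m + 1 ≤ n →
      (n ≤ h → TwoSquares.variance γ n m h = 0) ∧
      (2 * m ≤ h → h + 1 ≤ n →
        TwoSquares.variance γ n m h
          = (q : ℝ) ^ (2 * m + h) / (q : ℝ) ^ (2 * n) * ((q : ℝ) ^ n - (q : ℝ) ^ h)) ∧
      (m ≤ h → h + 1 ≤ 2 * m →
        TwoSquares.variance γ n m h
          = (q : ℝ) ^ (2 * h) / (q : ℝ) ^ (2 * n) * ((q : ℝ) ^ n - (q : ℝ) ^ (2 * m))) ∧
      (h + 1 ≤ m →
        TwoSquares.variance γ n m h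
          = (q : ℝ) ^ (m + h) / (q : ℝ) ^ (2 * n) * ((q : ℝ) ^ n - (q : ℝ) ^ (m + h)))) ∧
    (m = 0 → 1 ≤ n →
      (n ≤ h → TwoSquares.variance γ n m h = 0) ∧
      (h + 1 ≤ n →
        TwoSquares.variance γ n m h
          = (q : ℝ) ^ h / (q : ℝ) ^ (2 * n) * ((q : ℝ) ^ n - (q : ℝ) ^ h))) := by
  subst hq
  have h2 : (2 : F) ≠ 0 := by
    refine Ring.two_ne_zero fun hc => ?_
    have := FiniteField.even_card_of_char_two hc
    rw [Nat.odd_iff] at hodd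
    omega
  have hq0 : (Fintype.card F : ℝ) ≠ 0 := by exact_mod_cast Fintype.card_ne_zero
  generalize hQ : (Fintype.card F : ℝ) = Q at hq0 ⊢
  have hconst {k : ℕ} (hmn : m < n) (hk : ∀ Y ∈ TwoSquares.monics F n,
      ∀ W ∈ TwoSquares.monics F m, TwoSquares.kerCount n m h Y W = Fintype.card F ^ k) :
      TwoSquares.variance γ n m h = (Q ^ (h + n + m + k) - Q ^ (2 * h + 2 * m)) / Q ^ (2 * n) := by
    rw [TwoSquares.variance_of_kerCount hγ h2 hmn hh hk, hQ]
  -- The condition `n + k = m + h` says that the second moment equals the square of the mean.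
  have hzero {k : ℕ} (hmn : m < n) (hk' : n + k = m + h) (hk : ∀ Y ∈ TwoSquares.monics F n,
      ∀ W ∈ TwoSquares.monics F m, TwoSquares.kerCount n m h Y W = Fintype.card F ^ k) :
      TwoSquares.variance γ n m h = 0 := by
    rw [hconst hmn hk, show h + n + m + k = 2 * h + 2 * m by omega, sub_self, zero_div]
  have hlarge (hmn : m < n) (h1 : m ≤ h) (h1' : n ≤ 2 * m ∨ n ≤ h) :
      TwoSquares.variance γ n m h = 0 := by
    rcases le_total h (2 * m) with h3 | h3
    · rcases le_total n (2 * m) with h4 | h4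
      · exact hzero (k := m + h - n) hmn (by omega)
          fun Y hY W hW => TwoSquares.kerCount_of_le_two_mul hmn.le h4 h1 h3 hY hW
      -- The assumptions force `n = 2 * m` here.
      · refine hzero (k := min (h - m) m) hmn (by omega)
          fun Y hY W hW => TwoSquares.kerCount_of_le_of_two_mul_le h4 (by omega) hY hW
    · exact hzero (k := h - n + m) hmn (by omega)
        fun Y hY W hW => TwoSquares.kerCount_of_two_mul_le hmn.le h3 hh hY hW
  have hsmall (hmn : m < n) (h1 : 2 * m ≤ n) (h3 : h ≤ n) : TwoSquares.variance γ n m h =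
      (Q ^ (h + n + m + min (h - m) m) - Q ^ (2 * h + 2 * m)) / Q ^ (2 * n) :=
    hconst hmn fun Y hY W hW => TwoSquares.kerCount_of_le_of_two_mul_le h1 h3 hY hW
  have hgcd (hmn : m < n) (h1 : n ≤ 2 * m) (h3 : h ≤ m) : TwoSquares.variance γ n m h =
      (Q ^ h * (Q ^ (n - m) * TwoSquares.smallGcdSum F h m (2 * m - n))
        - Q ^ (2 * h + 2 * m)) / Q ^ (2 * n) := by
    rw [TwoSquares.variance_eq hmn hh, TwoSquares.pairCount_eq_smallGcdSum hγ h2 hmn.le h1 h3, hQ]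
  refine ⟨fun hm hmn hn => ⟨fun h1 => hlarge hmn h1 (by omega), fun h1 h3 => ?_, fun h1 => ?_⟩,
    fun hm hn => ⟨fun h1 => hlarge (by omega) h1 (by omega), fun h1 => ?_⟩,
    fun hm hn => ⟨fun h1 => hlarge (by omega) (by omega) (by omega), fun h1 h3 => ?_,
      fun h1 h3 => ?_, fun h1 => ?_⟩,
    fun hm hn => ⟨fun h1 => hlarge (by omega) (by omega) (by omega), fun h1 => ?_⟩⟩
  · rw [hgcd hmn (by omega) (by omega), TwoSquares.smallGcdSum_of_le (by omega) (by omega), hQ]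
    -- With `s = n - m` and `a = 2 * m - n`, all exponents become free of subtraction.
    obtain ⟨s, rfl⟩ : ∃ s, n = m + s := ⟨n - m, by omega⟩
    obtain ⟨a, rfl⟩ : ∃ a, m = s + a := ⟨m - s, by omega⟩
    rw [show s + a + s - (s + a) = s by omega, show 2 * (s + a) - (s + a + s) = a by omega]
    field_simp
    ring
  · obtain ⟨s, rfl⟩ : ∃ s, n = m + s := ⟨n - m, by omega⟩
    -- Here `k + 1 = 2 * m - n - h`, the linear factor in the formula.
    obtain ⟨k, rfl⟩ : ∃ k, m = s + (h + k) + 1 := ⟨m - s - h - 1, by omega⟩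
    rw [hgcd hmn (by omega) (by omega),
      show 2 * (s + (h + k) + 1) - (s + (h + k) + 1 + s) = h + (k + 1) by omega,
      TwoSquares.smallGcdSum_add (by omega), hQ, Nat.add_sub_cancel_left, Nat.add_sub_cancel]
    push_cast
    field_simp
    ring
  · subst hn
    rw [hsmall (by omega) le_rfl (by omega), show min (h - m) m = 0 by omega]
    field_simp
    ring
  · rw [hsmall (by omega) (by omega) (by omega), show min (h - m) m = m by omega]
    field_simp
    ring
  · obtain ⟨t, rfl⟩ : ∃ t, h = m + t := ⟨h - m, by omega⟩
    rw [hsmall (by omega) (by omega) (by omega), show min (m + t - m) m = t by omega]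
    field_simp
    ring
  · rw [hsmall (by omega) (by omega) (by omega), show min (h - m) m = 0 by omega]
    field_simp
    ring
  · subst hm
    rw [hsmall (by omega) (by omega) (by omega), show min (h - 0) 0 = 0 by omega]
    field_simp
    ring
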